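/- **Setting.** A network has a macro base station (MBS), indexed $0$, small base stations (SBSs) $1,\dots,N$, and contents $1,\dots,M$. BS $n$ stores the contents $\mathcal M_n\subseteq\mathcal M=\{1,\dots,M\}$, with $\mathcal M_0=\mathcal M$; write $\mathcal N=\{0,1,\dots,N\}$ and $\mathcal N_m=\{n\ge 1: m\in\mathcal M_n\}$. The state is $\mathbf Q=(Q_{n,m})_{n\in\mathcal N,\,m\in\mathcal M_n}$ with $Q_{n,m}\in\{0,\dots,N_{n,m}\}$, $N_{n,m}<\infty$. A feasible action is $\mathbf u=(u_n)_{n\in\mathcal N}$ with $u_n\in\mathcal M_n\cup\{0\}$ ($0$: idle) and $u_0\sum_{n\ge1}u_n=0$; $\mathcal U$ is the set of feasible actions. In each slot, independent arrivals $A_{n,m}\in\{0,1,\dots\}$ ($n\in\mathcal N$, $m\in\mathcal M$), i.i.d. over slots, occur, and the next state $\mathbf Q'$ is $$Q'_{0,m}=\min\{\mathbf 1(u_0\ne m)Q_{0,m}+A_{0,m}+\textstyle\sum_{n\ge1,\,n\notin\mathcal N_m}A_{n,m},\,N_{0,m}\},$$ $$Q'_{n,m}=\min\{\mathbf 1(u_0\ne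 m,\ u_n\ne m)Q_{n,m}+A_{n,m},\,N_{n,m}\}\quad(n\ge1,\ m\in\mathcal M_n).$$ The stage cost is $g(\mathbf Q,\mathbf u)=\sum_{n,m}Q_{n,m}+w\sum_n p(n,u_n)$ with $w\ge0$, $p(n,m)\ge0$, $p(n,0)=0$. A stationary policy is a map $\mu$ from states to $\mathcal U$; its average cost from $\mathbf Q(1)$ is $\limsup_{T\to\infty}\frac1T\sum_{t=1}^T\mathbb E[g(\mathbf Q(t),\mu(\mathbf Q(t)))]$. For a function $V$ of the state let $J(\mathbf Q,\mathbf u)=g(\mathbf Q,\mathbf u)+\mathbb E[V(\mathbf Q')]$ and $\Delta_{\mathbf u,\mathbf v}(\mathbf Q)=J(\mathbf Q,\mathbf u)-J(\mathbf Q,\mathbf v)$. The Bellman equation for $(\theta,V)$ is $\theta+V(\mathbf Q)=\min_{\mathbf u\in\mathcal U}J(\mathbf Q,\mathbf u)$ for all $\mathbf Q$. Given $V$, an action $\mathbf u$ is *optimal at $\mathbf Q$*, written $\mu^*(\mathbf Q)=\mathbf u$ (ties allowed), if it minimizes $J(\mathbf Q,\cdot)$ over $\mathcal U$. Let $\mathbf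 Q_{-n,-m}$ be $\mathbf Q$ without its entry $(n,m)$, and let $\Phi_{\mathbf u}(\mathbf Q_{-n,-m})$ be the set of values $Q_{n,m}\in\{0,\dots,N_{n,m}\}$ with $\Delta_{\mathbf u,\mathbf v}(Q_{n,m},\mathbf Q_{-n,-m})\le0$ for all $\mathbf v\in\mathcal U$, $\mathbf v\neq\mathbf u$. Put $\phi^+_{\mathbf u}=\max\Phi_{\mathbf u}$ ($-\infty$ if $\Phi_{\mathbf u}=\emptyset$) and $\phi^-_{\mathbf u}=\min\Phi_{\mathbf u}$ ($+\infty$ if $\Phi_{\mathbf u}=\emptyset$). **Theorem 1 (Structural properties of $\mu^*$).** The Bellman equation has a solution. Let $(\theta,V)$ be any solution. Then, for every initial state, $\theta$ is the minimum average cost over all stationary policies, and every policy that picks an optimal action at each state attains it. Moreover: 1. $\mu^*(\mathbf Q)=\mathbf 0$ for every $\mathbf Q$ such that $Q_{n,m}\le\phi^+_{\mathbf 0}(\mathbf Q_{-n,-m})$ for all $n\in\mathcal N$ and $m\in\mathcal M_n$. 2. Let $\mathbf u^*\in\mathcal U$, and suppose $u^*_n=m\in\mathcal M_n$ for some $n\in\mathcal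 N$. Then $\mu^*(\mathbf Q)=\mathbf u^*$ for every state $\mathbf Q$ with $Q_{n,m}\ge\phi^-_{\mathbf u^*}(\mathbf Q_{-n,-m})$. If $u^*_0=m\in\mathcal M$, then $\phi^-_{\mathbf u^*}(\mathbf Q_{-0,-m})$ is non-increasing in $Q_{n,m}$ for every $n\in\mathcal N_m$. -/

import Mathlib

open scoped NNReal

noncomputable section

/-- A cache-enabled heterogeneous cellular network with one macro base station (MBS, index `0`),
`N` small base stations (SBSs, the nonzero indices of `Fin (N + 1)`) and `M` contents. -/
structure HetNet where
  /-- number of SBSs -/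
  N : ℕ
  /-- number of contents -/
  M : ℕ
  /-- `cached n` is the set of contents stored at BS `n` -/
  cached : Fin (N + 1) → Finset (Fin M)
  /-- the MBS stores every content -/
  cached_zero : cached 0 = Finset.univ
  /-- upper limit of the counter of queue `(n, m)` -/
  cap : Fin (N + 1) → Fin M → ℕ
  /-- power that BS `n` needs to multicast content `m` -/
  power : Fin (N + 1) → Fin M → ℝ≥0
  /-- weight of the power cost -/
  w : ℝ≥0
  /-- distribution, in each slot, of the number of new requests for content `m` from the users
  of area `n` (area `0`: the users that no SBS covers) -/
  arrival : Fin (N + 1) → Fin M → PMF ℕ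

namespace HetNet

variable (S : HetNet)

/-- The request queues: pairs `(n, m)` with content `m` stored at BS `n`. -/
abbrev Queue : Type := {i : Fin (S.N + 1) × Fin S.M // i.2 ∈ S.cached i.1}

/-- The request queue states `(Q_{n,m})`, with `Q_{n,m} ∈ {0, …, cap n m}`. -/
abbrev State : Type := ∀ i : S.Queue, Fin (S.cap i.1.1 i.1.2 + 1)

/-- Feasible multicast scheduling actions. `u n = none` means that BS `n` is idle, and
`u n = some m` that it multicasts content `m`, which it must store. The MBS does not transmit
together with any SBS. -/
abbrev Action : Type :=
  {u : Fin (S.N + 1) → Option (Fin S.M) //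
    (∀ n m, u n = some m → m ∈ S.cached n) ∧ (u 0 = none ∨ ∀ n, n ≠ 0 → u n = none)}

/-- The action `0`: every BS is idle. -/
def idle : S.Action := ⟨fun _ => none, by simp, Or.inl rfl⟩

/-- Stationary multicast scheduling policies. -/
abbrev Policy : Type := S.State → S.Action

/-- One slot's request arrivals `(A_{n,m})`. -/
abbrev Arrivals : Type := Fin (S.N + 1) × Fin S.M → ℕ

/-- The law of one slot's arrivals: independent over `(n, m)`. -/
def arrivalLaw : MeasureTheory.Measure S.Arrivals :=
  MeasureTheory.Measure.pi fun i => (S.arrival i.1 i.2).toMeasure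

/-- The arrivals entering queue `(n, m)`. The queue `(0, m)` also gets the requests for `m` from
the areas of the SBSs that do not store `m`. -/
def inflow (A : S.Arrivals) (i : S.Queue) : ℕ :=
  if i.1.1 = 0 then
    A (0, i.1.2) + ∑ n with n ≠ 0 ∧ i.1.2 ∉ S.cached n, A (n, i.1.2)
  else A i.1

/-- The next state: a queue is emptied if the MBS or its own BS multicasts its content, then the
arrivals are added, and the result is truncated at the upper limit of the queue. -/
def next (Q : S.State) (u : S.Action) (A : S.Arrivals) : S.State := fun i =>
  ⟨min ((if u.1 0 ≠ some i.1.2 ∧ u.1 i.1.1 ≠ some i.1.2 then (Q i : ℕ) else 0) + S.inflow A i)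
      (S.cap i.1.1 i.1.2),
    Nat.lt_succ_of_le (min_le_right _ _)⟩

/-- The transition probability `Pr[Q' | Q, u]`. -/
def trans (Q : S.State) (u : S.Action) (Q' : S.State) : ℝ :=
  S.arrivalLaw.real {A | S.next Q u A = Q'}

/-- Delay cost `d(Q)`: the total number of pending requests. -/
def delayCost (Q : S.State) : ℝ := ∑ i, ((Q i : ℕ) : ℝ)

/-- Network power cost `p(u)`. -/
def powerCost (u : S.Action) : ℝ := ∑ n, (u.1 n).elim 0 fun m => (S.power n m : ℝ)

/-- Per-stage network cost `g(Q, u) = d(Q) + w p(u)`. -/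
def stageCost (Q : S.State) (u : S.Action) : ℝ := S.delayCost Q + S.w * S.powerCost u

/-- The distribution after `t` transitions of the Markov chain that `μ` induces from the initial
state `Q₁`. -/
def stateProb (μ : S.Policy) (Q₁ : S.State) : ℕ → S.State → ℝ
  | 0, Q' => if Q' = Q₁ then 1 else 0
  | t + 1, Q' => ∑ Q, stateProb μ Q₁ t Q * S.trans Q (μ Q) Q'

/-- The expected stage cost after `t` transitions. -/
def expCost (μ : S.Policy) (Q₁ : S.State) (t : ℕ) : ℝ :=
  ∑ Q, S.stateProb μ Q₁ t Q * S.stageCost Q (μ Q)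

/-- The long-run average network cost of `μ` from the initial state `Q₁`: the limit superior of
the expected costs averaged over the first `T` slots. -/
def avgCost (μ : S.Policy) (Q₁ : S.State) : ℝ :=
  Filter.limsup (fun T : ℕ => (∑ t ∈ Finset.range T, S.expCost μ Q₁ t) / (T : ℝ)) Filter.atTop

/-- The state-action cost `J(Q, u) = g(Q, u) + E[V(Q')]`. -/
def J (V : S.State → ℝ) (Q : S.State) (u : S.Action) : ℝ :=
  S.stageCost Q u + ∫ A, V (S.next Q u A) ∂S.arrivalLaw

/-- The Bellman equation: `θ + V(Q) = min_u J(Q, u)` for every state `Q`. -/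
def IsBellmanSolution (θ : ℝ) (V : S.State → ℝ) : Prop :=
  ∀ Q, IsLeast (Set.range (S.J V Q)) (θ + V Q)

/-- `Δ_{u,v}(Q) = J(Q, u) - J(Q, v)`. -/
def Delta (V : S.State → ℝ) (u v : S.Action) (Q : S.State) : ℝ := S.J V Q u - S.J V Q v

/-- The set `argmin_u J(Q, u)` of optimal actions at state `Q`. -/
def optimalActions (V : S.State → ℝ) (Q : S.State) : Set S.Action :=
  {u | ∀ v, S.J V Q u ≤ S.J V Q v}

open Classical in
/-- `Φ_u(Q_{-i})`: the values of the coordinate `i = (n, m)` for which `u` dominates every other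
action, the other coordinates being those of `Q`. The coordinate `Q i` plays no role. -/
def Phi (V : S.State → ℝ) (u : S.Action) (i : S.Queue) (Q : S.State) :
    Finset (Fin (S.cap i.1.1 i.1.2 + 1)) :=
  {x | ∀ v, v ≠ u → S.Delta V u v (Function.update Q i x) ≤ 0}

/-- `φ_u^+(Q_{-i})`: the maximum of `Φ_u(Q_{-i})`, and `-∞` if that set is empty. -/
def phiPlus (V : S.State → ℝ) (u : S.Action) (i : S.Queue) (Q : S.State) :
    WithBot (Fin (S.cap i.1.1 i.1.2 + 1)) :=
  (S.Phi V u i Q).max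

/-- `φ_u^-(Q_{-i})`: the minimum of `Φ_u(Q_{-i})`, and `+∞` if that set is empty. -/
def phiMinus (V : S.State → ℝ) (u : S.Action) (i : S.Queue) (Q : S.State) :
    WithTop (Fin (S.cap i.1.1 i.1.2 + 1)) :=
  (S.Phi V u i Q).min

/-- The idle region: the states with `Q_{n,m} ≤ φ_0^+(Q_{-n,-m})` for every queue `(n, m)`. -/
def idleRegion (V : S.State → ℝ) : Set S.State :=
  {Q | ∀ i, (Q i : WithBot (Fin (S.cap i.1.1 i.1.2 + 1))) ≤ S.phiPlus V S.idle i Q}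

/-- The queue `(0, m)` of the MBS. -/
def mbsQueue (m : Fin S.M) : S.Queue := ⟨(0, m), by simp [S.cached_zero]⟩

end HetNet

end

open MeasureTheory Filter Topology

namespace HetNet

variable (S : HetNet)

/-! Every solution `V` of the Bellman equation is monotone (`IsDiscountedSolution.monotone`), and
the structural claims follow from one comparison, `Delta_le_of_serves`. Raise only queues that `u`
empties: the next state under `u` is unchanged, so `J(·, u)` grows by exactly the extra delay cost.
Under any other action it grows by at least that much, since `V` is monotone. Hence `u` gains on
every competitor, and idling loses to any action that serves the raised queue.

Optimality of `θ` comes from telescoping the Bellman residuals along a policy: they are nonnegative,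
vanish for optimal actions, and the boundary terms are bounded, hence negligible after division by
`T`.

Existence uses vanishing discount. Discounted solutions are fixed points of a contraction; the work
is to bound `V Q - V 0` independently of the discount. Run two ordered copies with the same actions
and arrivals. In a queue with random inflow, each arrival lifts the lower copy until the two meet,
so the expected total delay difference is bounded by `couplingPotential`. Queues that almost surely
receive nothing may never meet; the MBS clears them by multicasting each content once, at bounded
cost (`le_of_cleared`). Compactness then gives a limit point. -/

/-! ### Expectations over one slot's arrivals. -/

instance : IsProbabilityMeasure S.arrivalLaw := by
  unfold arrivalLaw; infer_instance

/-- The arrival space is countable, so measurability is automatic, and a function factoring through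
a finite type is bounded. -/
lemma integrable_comp_finite {α : Type*} [Finite α] (f : α → ℝ) (g : S.Arrivals → α) :
    Integrable (fun A => f (g A)) S.arrivalLaw := by
  obtain ⟨C, hC⟩ := (Set.finite_range fun a => ‖f a‖).bddAbove
  exact Integrable.of_bound (measurable_of_countable _).aestronglyMeasurable C
    (Eventually.of_forall fun A => hC ⟨g A, rfl⟩)

lemma integrable_next (V : S.State → ℝ) (Q : S.State) (u : S.Action) :
    Integrable (fun A => V (S.next Q u A)) S.arrivalLaw :=
  S.integrable_comp_finite V _

lemma integral_next (V : S.State → ℝ) (Q : S.State) (u : S.Action) :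
    ∫ A, V (S.next Q u A) ∂S.arrivalLaw = ∑ Q', S.trans Q u Q' * V Q' := by
  have hm : Measurable (S.next Q u) := measurable_of_countable _
  have : IsProbabilityMeasure (S.arrivalLaw.map (S.next Q u)) :=
    Measure.isProbabilityMeasure_map hm.aemeasurable
  rw [← integral_map (φ := S.next Q u) (f := V) hm.aemeasurable
    (measurable_of_countable _).aestronglyMeasurable, integral_fintype .of_finite]
  refine Finset.sum_congr rfl fun Q' _ => ?_
  rw [smul_eq_mul, trans, map_measureReal_apply hm (measurableSet_singleton _)]
  rfl

lemma trans_nonneg (Q : S.State) (u : S.Action) (Q' : S.State) : 0 ≤ S.trans Q u Q' :=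
  measureReal_nonneg

/-! ### Order properties of the dynamics and the costs. -/

/-- Queue `i` is emptied under the action `u`. -/
def Serves (u : S.Action) (i : S.Queue) : Prop := u.1 0 = some i.1.2 ∨ u.1 i.1.1 = some i.1.2

variable {S}

lemma next_of_serves {u : S.Action} {i : S.Queue} (h : S.Serves u i) (Q : S.State)
    (A : S.Arrivals) : (S.next Q u A i : ℕ) = min (S.inflow A i) (S.cap i.1.1 i.1.2) := by
  have : ¬ (u.1 0 ≠ some i.1.2 ∧ u.1 i.1.1 ≠ some i.1.2) := by
    unfold Serves at h; tauto
  simp only [next, if_neg this, zero_add]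

lemma next_of_not_serves {u : S.Action} {i : S.Queue} (h : ¬ S.Serves u i) (Q : S.State)
    (A : S.Arrivals) :
    (S.next Q u A i : ℕ) = min ((Q i : ℕ) + S.inflow A i) (S.cap i.1.1 i.1.2) := by
  have : u.1 0 ≠ some i.1.2 ∧ u.1 i.1.1 ≠ some i.1.2 := by
    unfold Serves at h; tauto
  simp only [next, if_pos this]

lemma next_apply_congr {Q R : S.State} (u : S.Action) (A : S.Arrivals) {i : S.Queue}
    (h : ¬ S.Serves u i → Q i = R i) : S.next Q u A i = S.next R u A i := by
  apply Fin.ext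
  by_cases hs : S.Serves u i
  · rw [next_of_serves hs, next_of_serves hs]
  · rw [next_of_not_serves hs, next_of_not_serves hs, h hs]

lemma next_mono {Q R : S.State} (h : Q ≤ R) (u : S.Action) (A : S.Arrivals) :
    S.next Q u A ≤ S.next R u A := by
  intro i
  have hi : (Q i : ℕ) ≤ R i := h i
  rw [Fin.le_def]
  by_cases hs : S.Serves u i
  · rw [next_of_serves hs, next_of_serves hs]
  · rw [next_of_not_serves hs, next_of_not_serves hs]
    omega

lemma delayCost_mono {Q R : S.State} (h : Q ≤ R) : S.delayCost Q ≤ S.delayCost R :=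
  Finset.sum_le_sum fun i _ => Nat.cast_le.2 (h i)

lemma eq_of_le_of_delayCost_le {Q R : S.State} (h : Q ≤ R)
    (hd : S.delayCost R ≤ S.delayCost Q) : Q = R := by
  have := (Finset.sum_eq_sum_iff_of_le (s := Finset.univ)
    (f := fun i : S.Queue => ((Q i : ℕ) : ℝ)) (g := fun i => ((R i : ℕ) : ℝ))
    fun i _ => Nat.cast_le.2 (h i)).1 (le_antisymm (delayCost_mono h) hd)
  ext i
  exact_mod_cast this i (Finset.mem_univ i)

lemma stageCost_nonneg (Q : S.State) (u : S.Action) : 0 ≤ S.stageCost Q u := by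
  have : 0 ≤ S.powerCost u := by
    refine Finset.sum_nonneg fun n _ => ?_
    cases u.1 n <;> simp
  have hd : 0 ≤ S.delayCost Q := Finset.sum_nonneg fun i _ => Nat.cast_nonneg _
  unfold stageCost
  positivity

variable (S) in
lemma exists_stageCost_le : ∃ G : ℝ, ∀ (Q : S.State) (u : S.Action), S.stageCost Q u ≤ G := by
  obtain ⟨G, hG⟩ := (Set.finite_range fun x : S.State × S.Action => S.stageCost x.1 x.2).bddAbove
  exact ⟨G, fun Q u => hG ⟨(Q, u), rfl⟩⟩

/-! ### Optimality equations and monotonicity of their solutions. -/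

/-- `c + V(Q) = min_u (g(Q, u) + α E[V(Q')])` for every state `Q`: the discounted optimality
equation for `c = 0`, and the Bellman equation for `α = 1`. -/
def IsDiscountedSolution (S : HetNet) (α c : ℝ) (V : S.State → ℝ) : Prop :=
  ∀ Q, IsLeast (Set.range fun u => S.stageCost Q u + α * ∫ A, V (S.next Q u A) ∂S.arrivalLaw)
    (c + V Q)

lemma isDiscountedSolution_one {θ : ℝ} {V : S.State → ℝ} :
    S.IsDiscountedSolution 1 θ V ↔ S.IsBellmanSolution θ V := by
  unfold IsDiscountedSolution IsBellmanSolution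
  refine forall_congr' fun Q => ?_
  have : (fun u => S.stageCost Q u + 1 * ∫ A, V (S.next Q u A) ∂S.arrivalLaw) = S.J V Q := by
    funext u; rw [one_mul, J]
  rw [this]

namespace IsDiscountedSolution

variable {α c : ℝ} {V : S.State → ℝ}

/-- An action optimal at `R` is also tried at `Q`, so the power costs cancel. -/
lemma exists_sub_le (h : S.IsDiscountedSolution α c V) (R : S.State) : ∃ u : S.Action, ∀ Q,
    V Q - V R ≤ S.delayCost Q - S.delayCost R +
      α * ∫ A, (V (S.next Q u A) - V (S.next R u A)) ∂S.arrivalLaw := by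
  obtain ⟨u, hu⟩ := (h R).1
  refine ⟨u, fun Q => ?_⟩
  have hQ := (h Q).2 ⟨u, rfl⟩
  rw [integral_sub (S.integrable_next _ _ _) (S.integrable_next _ _ _)]
  simp only [stageCost] at hu hQ
  linarith

/-- Take an ordered pair with the largest violation `D ≥ 0`. One coupled step keeps the order, so
`D` is at most the delay difference plus `D`. The delay difference is therefore nonnegative, which
forces the two states to coincide and `D = 0`. No strict discount is needed, so the Bellman case `α
= 1` is covered. -/
lemma monotone (h : S.IsDiscountedSolution α c V) (h0 : 0 ≤ α) (h1 : α ≤ 1) : Monotone V := by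
  let P := {p : S.State × S.State // p.1 ≤ p.2}
  have : Nonempty P := ⟨⟨(fun _ => 0, fun _ => 0), le_rfl⟩⟩
  obtain ⟨⟨⟨Q₀, R₀⟩, h₀⟩, hmax⟩ := Finite.exists_max fun p : P => V p.1.1 - V p.1.2
  have hD : ∀ {Q R : S.State}, Q ≤ R → V Q - V R ≤ V Q₀ - V R₀ := fun {Q R} hQR =>
    hmax ⟨(Q, R), hQR⟩
  have hD0 : 0 ≤ V Q₀ - V R₀ := by simpa using hD (le_refl Q₀)
  obtain ⟨u, hu⟩ := h.exists_sub_le R₀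
  have hE : ∫ A, (V (S.next Q₀ u A) - V (S.next R₀ u A)) ∂S.arrivalLaw ≤ V Q₀ - V R₀ := by
    refine (integral_mono ((S.integrable_next _ _ _).sub (S.integrable_next _ _ _))
      (integrable_const _) fun A => hD (next_mono h₀ u A)).trans ?_
    simp
  have hE' := mul_le_mul_of_nonneg_left hE h0
  have hα := mul_le_mul_of_nonneg_right h1 hD0
  have heq : Q₀ = R₀ := eq_of_le_of_delayCost_le h₀ (by linarith [hu Q₀])
  intro Q R hQR
  have := hD hQR
  rw [heq] at this
  linarith

end IsDiscountedSolution

/-! ### Comparison of actions and thresholds. -/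

lemma J_congr_of_serves (V : S.State → ℝ) (u : S.Action) {Q R : S.State}
    (h : ∀ i, ¬ S.Serves u i → Q i = R i) :
    S.J V R u - S.J V Q u = S.delayCost R - S.delayCost Q := by
  have : ∀ A, S.next Q u A = S.next R u A := fun A => funext fun i => next_apply_congr u A (h i)
  simp only [J, stageCost, this]
  ring

lemma Delta_le_of_serves {V : S.State → ℝ} (hV : Monotone V) (u v : S.Action) {Q R : S.State}
    (hQR : Q ≤ R) (h : ∀ i, ¬ S.Serves u i → Q i = R i) : S.Delta V u v R ≤ S.Delta V u v Q := by
  have h1 := J_congr_of_serves V u h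
  have h2 : S.delayCost R - S.delayCost Q ≤ S.J V R v - S.J V Q v := by
    have := integral_mono (S.integrable_next V Q v) (S.integrable_next V R v)
      fun A => hV (next_mono hQR v A)
    simp only [J, stageCost]
    linarith
  unfold Delta
  linarith

lemma Delta_swap (V : S.State → ℝ) (u v : S.Action) (Q : S.State) :
    S.Delta V u v Q = - S.Delta V v u Q := by
  unfold Delta; ring

lemma exists_serves_of_ne_idle {u : S.Action} (hu : u ≠ S.idle) : ∃ i, S.Serves u i := by
  by_contra! hc
  refine hu (Subtype.ext (funext fun n => ?_))
  change u.1 n = none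
  by_contra hn
  obtain ⟨m, hm⟩ := Option.ne_none_iff_exists'.1 hn
  exact hc ⟨(n, m), u.2.1 n m hm⟩ (Or.inr hm)

lemma eq_update_of_not_serves {u : S.Action} {i : S.Queue} (hi : S.Serves u i) (Q : S.State)
    (x : Fin (S.cap i.1.1 i.1.2 + 1)) (j : S.Queue) (hj : ¬ S.Serves u j) :
    Q j = Function.update Q i x j := by
  rw [Function.update_of_ne]
  rintro rfl
  exact hj hi

/-- A competitor `v` serves some queue `i`. Idling beats `v` when that queue is raised to its
threshold, and lowering it back to `Q i` only hurts `v`. The queue depends on `v`, which is why all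
coordinates must lie below their thresholds. -/
lemma idle_mem_optimalActions {V : S.State → ℝ} (hV : Monotone V) {Q : S.State}
    (hQ : Q ∈ S.idleRegion V) : S.idle ∈ S.optimalActions V Q := by
  intro v
  rcases eq_or_ne v S.idle with rfl | hv
  · exact le_rfl
  obtain ⟨i, hi⟩ := exists_serves_of_ne_idle hv
  have hQi := hQ i
  obtain ⟨x, hx⟩ : ∃ x : Fin (S.cap i.1.1 i.1.2 + 1),
      S.phiPlus V S.idle i Q = (x : WithBot _) := by
    refine ⟨_, (WithBot.coe_unbot _ fun hbot => ?_).symm⟩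
    rw [hbot] at hQi
    exact absurd hQi (WithBot.not_coe_le_bot _)
  rw [hx, WithBot.coe_le_coe] at hQi
  have hmem := Finset.mem_of_max hx
  simp only [Phi, Finset.mem_filter, Finset.mem_univ, true_and] at hmem
  have h1 := hmem v hv
  have h2 := Delta_le_of_serves hV v S.idle (R := Function.update Q i x)
    (le_update_self_iff.2 hQi) (eq_update_of_not_serves hi Q x)
  rw [Delta_swap] at h1
  unfold Delta at h1 h2
  linarith

lemma mem_optimalActions_of_phiMinus_le {V : S.State → ℝ} (hV : Monotone V) {u : S.Action}
    {i : S.Queue} (hi : S.Serves u i) {Q : S.State}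
    (hQ : S.phiMinus V u i Q ≤ (Q i : WithTop (Fin (S.cap i.1.1 i.1.2 + 1)))) :
    u ∈ S.optimalActions V Q := by
  intro v
  rcases eq_or_ne v u with rfl | hv
  · exact le_rfl
  obtain ⟨x, hx, hxQ⟩ := WithTop.le_coe_iff.1 hQ
  have hmem := Finset.mem_of_min hx
  simp only [Phi, Finset.mem_filter, Finset.mem_univ, true_and] at hmem
  have h1 := hmem v hv
  have h2 := Delta_le_of_serves hV u v (Q := Function.update Q i x) (R := Q)
    (update_le_self_iff.2 hxQ) fun j hj => (eq_update_of_not_serves hi Q x j hj).symm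
  unfold Delta at h1 h2
  linarith

/-- Raising queues that `u` serves enlarges `Phi`, so its minimum drops. -/
lemma phiMinus_mono {V : S.State → ℝ} (hV : Monotone V) {u : S.Action} (i : S.Queue)
    {Q R : S.State} (hQR : Q ≤ R) (h : ∀ j, ¬ S.Serves u j → Q j = R j) :
    S.phiMinus V u i R ≤ S.phiMinus V u i Q := by
  refine Finset.min_mono fun x hx => ?_
  simp only [Phi, Finset.mem_filter, Finset.mem_univ, true_and] at hx ⊢
  refine fun v hv => (Delta_le_of_serves hV u v ?_ fun j hj => ?_).trans (hx v hv)
  · exact update_le_update_iff.2 ⟨le_rfl, fun j _ => hQR j⟩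
  · rcases eq_or_ne j i with rfl | hji
    · simp
    · simp [Function.update_of_ne hji, h j hj]

/-! ### Average costs of stationary policies. -/

lemma stateProb_nonneg (μ : S.Policy) (Q₁ : S.State) (t : ℕ) (Q : S.State) :
    0 ≤ S.stateProb μ Q₁ t Q := by
  induction t generalizing Q with
  | zero => simp only [stateProb]; split_ifs <;> norm_num
  | succ t ih =>
    exact Finset.sum_nonneg fun R _ => mul_nonneg (ih R) (S.trans_nonneg _ _ _)

lemma sum_stateProb_succ (μ : S.Policy) (Q₁ : S.State) (t : ℕ) (V : S.State → ℝ) :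
    ∑ Q, S.stateProb μ Q₁ (t + 1) Q * V Q =
      ∑ Q, S.stateProb μ Q₁ t Q * ∫ A, V (S.next Q (μ Q) A) ∂S.arrivalLaw := by
  simp only [stateProb, integral_next, Finset.sum_mul, Finset.mul_sum]
  rw [Finset.sum_comm]
  simp only [mul_assoc]

lemma sum_stateProb (μ : S.Policy) (Q₁ : S.State) (t : ℕ) :
    ∑ Q, S.stateProb μ Q₁ t Q = 1 := by
  induction t with
  | zero => simp [stateProb]
  | succ t ih => simpa [ih] using sum_stateProb_succ μ Q₁ t fun _ => 1

lemma sum_stateProb_le (μ : S.Policy) (Q₁ : S.State) (t : ℕ) {f : S.State → ℝ} {B : ℝ}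
    (hf : ∀ Q, f Q ≤ B) : ∑ Q, S.stateProb μ Q₁ t Q * f Q ≤ B := by
  calc ∑ Q, S.stateProb μ Q₁ t Q * f Q ≤ ∑ Q, S.stateProb μ Q₁ t Q * B :=
        Finset.sum_le_sum fun Q _ => mul_le_mul_of_nonneg_left (hf Q) (stateProb_nonneg _ _ _ _)
    _ = B := by rw [← Finset.sum_mul, sum_stateProb, one_mul]

lemma abs_sum_stateProb_le (μ : S.Policy) (Q₁ : S.State) (t : ℕ) {f : S.State → ℝ} {B : ℝ}
    (hf : ∀ Q, |f Q| ≤ B) : |∑ Q, S.stateProb μ Q₁ t Q * f Q| ≤ B := by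
  refine (Finset.abs_sum_le_sum_abs _ _).trans ?_
  simp only [abs_mul, abs_of_nonneg (stateProb_nonneg μ Q₁ t _)]
  exact sum_stateProb_le μ Q₁ t hf

/-- Summing the expected Bellman residuals of a policy telescopes. -/
lemma sum_expCost (μ : S.Policy) (Q₁ : S.State) (θ : ℝ) (V : S.State → ℝ) (T : ℕ) :
    ∑ t ∈ Finset.range T, S.expCost μ Q₁ t =
      T * θ + V Q₁ - ∑ Q, S.stateProb μ Q₁ T Q * V Q +
        ∑ t ∈ Finset.range T, ∑ Q, S.stateProb μ Q₁ t Q * (S.J V Q (μ Q) - (θ + V Q)) := by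
  induction T with
  | zero => simp [stateProb]
  | succ T ih =>
    rw [Finset.sum_range_succ, Finset.sum_range_succ, ih, sum_stateProb_succ]
    have hs := sum_stateProb μ Q₁ T
    simp only [expCost, J, mul_sub, mul_add, Finset.sum_sub_distrib, Finset.sum_add_distrib,
      ← Finset.sum_mul, hs]
    push_cast
    ring

lemma exists_abs_le (V : S.State → ℝ) : ∃ B, ∀ Q, |V Q| ≤ B := by
  obtain ⟨B, hB⟩ := (Set.finite_range fun Q => |V Q|).bddAbove
  exact ⟨B, fun Q => hB ⟨Q, rfl⟩⟩

lemma tendsto_telescoped (μ : S.Policy) (Q₁ : S.State) (θ : ℝ) (V : S.State → ℝ) :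
    Tendsto (fun T : ℕ => (T * θ + V Q₁ - ∑ Q, S.stateProb μ Q₁ T Q * V Q) / (T : ℝ))
      atTop (𝓝 θ) := by
  obtain ⟨B, hB⟩ := exists_abs_le V
  have h0 : Tendsto (fun T : ℕ => (V Q₁ - ∑ Q, S.stateProb μ Q₁ T Q * V Q) / (T : ℝ))
      atTop (𝓝 0) := by
    refine squeeze_zero_norm (a := fun T : ℕ => (B + B) / (T : ℝ)) (fun T => ?_)
      (tendsto_const_div_atTop_nhds_zero_nat _)
    rw [norm_div, Real.norm_eq_abs, Real.norm_natCast]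
    gcongr
    exact (abs_sub _ _).trans (add_le_add (hB _) (abs_sum_stateProb_le μ Q₁ T hB))
  have := h0.const_add θ
  rw [add_zero] at this
  refine this.congr' ?_
  filter_upwards [eventually_gt_atTop 0] with T hT
  field_simp
  ring

lemma IsBellmanSolution.avgCost_eq {θ : ℝ} {V : S.State → ℝ} (h : S.IsBellmanSolution θ V)
    {μ : S.Policy} (hμ : ∀ Q, μ Q ∈ S.optimalActions V Q) (Q₁ : S.State) :
    S.avgCost μ Q₁ = θ := by
  refine Tendsto.limsup_eq ((tendsto_telescoped μ Q₁ θ V).congr fun T => ?_)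
  have hres : ∀ Q, S.J V Q (μ Q) - (θ + V Q) = 0 := fun Q => by
    obtain ⟨⟨u, hu⟩, hle⟩ := h Q
    have h1 := hμ Q u
    have h2 := hle ⟨μ Q, rfl⟩
    linarith
  simp [sum_expCost μ Q₁ θ V T, hres]

lemma IsBellmanSolution.le_avgCost {θ : ℝ} {V : S.State → ℝ} (h : S.IsBellmanSolution θ V)
    (μ : S.Policy) (Q₁ : S.State) : θ ≤ S.avgCost μ Q₁ := by
  obtain ⟨G, hG⟩ := S.exists_stageCost_le
  have hG0 : 0 ≤ G := (stageCost_nonneg Q₁ S.idle).trans (hG _ _)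
  have ht := tendsto_telescoped μ Q₁ θ V
  rw [← ht.limsup_eq]
  -- Comparing real limsups needs boundedness of the averages; it comes from the uniform stage cost
  -- bound `G`.
  refine limsup_le_limsup (Eventually.of_forall fun T => ?_) ht.isCoboundedUnder_le
    (isBoundedUnder_of ⟨G, fun T => ?_⟩)
  · dsimp only
    gcongr
    rw [sum_expCost μ Q₁ θ V T]
    refine le_add_of_nonneg_right (Finset.sum_nonneg fun t _ => Finset.sum_nonneg fun Q _ =>
      mul_nonneg (stateProb_nonneg _ _ _ _) (sub_nonneg.2 ((h Q).2 ⟨μ Q, rfl⟩)))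
  · refine div_le_of_le_mul₀ (Nat.cast_nonneg T) hG0 ?_
    calc ∑ t ∈ Finset.range T, S.expCost μ Q₁ t ≤ ∑ _t ∈ Finset.range T, G :=
          Finset.sum_le_sum fun t _ => sum_stateProb_le μ Q₁ t fun Q => hG Q _
      _ = G * T := by simp [mul_comm]

lemma IsBellmanSolution.isLeast_avgCost {θ : ℝ} {V : S.State → ℝ}
    (h : S.IsBellmanSolution θ V) (Q₁ : S.State) :
    IsLeast (Set.range fun μ : S.Policy => S.avgCost μ Q₁) θ := by
  choose μ hμ using fun Q => (h Q).1
  refine ⟨⟨μ, h.avgCost_eq (fun Q v => ?_) Q₁⟩, ?_⟩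
  · rw [hμ Q]
    exact (h Q).2 ⟨v, rfl⟩
  · rintro _ ⟨ν, rfl⟩
    exact h.le_avgCost ν Q₁

/-! ### The coupling potential. -/

/-- The probability that requests enter queue `i` in a slot. -/
noncomputable def inflowProb (S : HetNet) (i : S.Queue) : ℝ :=
  S.arrivalLaw.real {A | 0 < S.inflow A i}

lemma ae_inflow_eq_zero :
    ∀ᵐ A ∂S.arrivalLaw, ∀ i, S.inflowProb i = 0 → S.inflow A i = 0 := by
  rw [ae_all_iff]
  intro i
  by_cases hi : S.inflowProb i = 0
  · have h0 : S.arrivalLaw {A | 0 < S.inflow A i} = 0 :=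
      (measureReal_eq_zero_iff).1 hi
    filter_upwards [measure_eq_zero_iff_ae_notMem.1 h0] with A hA _
    simpa using hA
  · exact Eventually.of_forall fun A h => absurd h hi

open Classical in
/-- A bound for the expected total cost difference between coupled trajectories from `Q` and `R`:
the coordinates that have not met yet, weighted by the room left in the smaller one. -/
noncomputable def couplingPotential (S : HetNet) (K : ℝ) (Q R : S.State) : ℝ :=
  ∑ i, if Q i = R i then 0 else K * ((S.cap i.1.1 i.1.2 : ℝ) - (R i : ℕ))

lemma couplingPotential_nonneg {K : ℝ} (hK : 0 ≤ K) (Q R : S.State) :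
    0 ≤ S.couplingPotential K Q R := by
  refine Finset.sum_nonneg fun i _ => ?_
  split_ifs
  · exact le_rfl
  · have : ((R i : ℕ) : ℝ) ≤ S.cap i.1.1 i.1.2 := by exact_mod_cast Nat.lt_succ_iff.1 (R i).2
    exact mul_nonneg hK (by linarith)

lemma couplingPotential_le {K : ℝ} (hK : 0 ≤ K) (Q R : S.State) :
    S.couplingPotential K Q R ≤ ∑ i : S.Queue, K * (S.cap i.1.1 i.1.2 : ℝ) := by
  refine Finset.sum_le_sum fun i _ => ?_
  split_ifs
  · positivity
  · exact mul_le_mul_of_nonneg_left (by linarith [Nat.cast_nonneg (α := ℝ) (R i : ℕ)]) hK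

-- A coordinate that is still unequal after the step was not served. Its lower copy was strictly
-- below the cap, so truncation cannot absorb the first arriving request, and the room left shrinks
-- by at least one when there is inflow.
open Classical in
lemma couplingPotential_next_le {K : ℝ} (hK : 0 ≤ K) {Q R : S.State} (h : R ≤ Q) (u : S.Action)
    (A : S.Arrivals) :
    S.couplingPotential K (S.next Q u A) (S.next R u A) ≤ S.couplingPotential K Q R -
      ∑ i, (if Q i = R i then 0 else K) * {A | 0 < S.inflow A i}.indicator 1 A := by
  unfold couplingPotential
  rw [← Finset.sum_sub_distrib]
  refine Finset.sum_le_sum fun i _ => ?_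
  by_cases hi : Q i = R i
  · rw [next_apply_congr u A fun _ => hi]
    simp [hi]
  have hlt : (R i : ℕ) < Q i := lt_of_le_of_ne (h i) fun he => hi (Fin.ext he.symm)
  have hcap : (Q i : ℕ) ≤ S.cap i.1.1 i.1.2 := Nat.lt_succ_iff.1 (Q i).2
  have hind : ({A | 0 < S.inflow A i} : Set S.Arrivals).indicator (1 : S.Arrivals → ℝ) A =
      if 0 < S.inflow A i then 1 else 0 := by
    simp [Set.indicator_apply]
  simp only [if_neg hi, hind]
  rw [← mul_sub]
  have key : ∀ x : ℕ, ((R i : ℕ) + if 0 < S.inflow A i then 1 else 0) ≤ x →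
      K * ((S.cap i.1.1 i.1.2 : ℝ) - x) ≤ K * ((S.cap i.1.1 i.1.2 : ℝ) - (R i : ℕ) -
        if 0 < S.inflow A i then 1 else 0) := by
    intro x hx
    refine mul_le_mul_of_nonneg_left ?_ hK
    have : (((R i : ℕ) + if 0 < S.inflow A i then 1 else 0 : ℕ) : ℝ) ≤ x := Nat.cast_le.2 hx
    push_cast at this
    linarith
  -- Taking `x` to be the cap covers the case where the coordinates meet and the new term is zero.
  have key_zero : 0 ≤ K * ((S.cap i.1.1 i.1.2 : ℝ) - (R i : ℕ) -
      if 0 < S.inflow A i then 1 else 0) := by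
    have := key (S.cap i.1.1 i.1.2) (by split_ifs <;> omega)
    rwa [sub_self, mul_zero] at this
  by_cases he : S.next Q u A i = S.next R u A i
  · rwa [if_pos he]
  · rw [if_neg he]
    have := next_of_not_serves (fun hs => he (next_apply_congr u A fun hn => absurd hs hn)) R A
    refine key _ ?_
    by_cases hA : 0 < S.inflow A i
    · rw [if_pos hA]; omega
    · rw [if_neg hA]; omega

variable (S) in
/-- A weight for the coupling potential that makes it dominate the delay differences. -/
noncomputable def couplingWeight : ℝ := ∑ i : S.Queue, (S.cap i.1.1 i.1.2 : ℝ) / S.inflowProb i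

lemma inflowProb_nonneg (i : S.Queue) : 0 ≤ S.inflowProb i := measureReal_nonneg

lemma couplingWeight_nonneg : 0 ≤ S.couplingWeight :=
  Finset.sum_nonneg fun i _ => div_nonneg (Nat.cast_nonneg _) (inflowProb_nonneg i)

/-- Queues without inflow contribute `cap / 0 = 0` to the weight, so they do no harm to the sum. -/
lemma cap_le_couplingWeight_mul {i : S.Queue} (hi : S.inflowProb i ≠ 0) :
    (S.cap i.1.1 i.1.2 : ℝ) ≤ S.couplingWeight * S.inflowProb i := by
  rw [← div_le_iff₀ (lt_of_le_of_ne (inflowProb_nonneg i) hi.symm)]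
  exact Finset.single_le_sum (f := fun i : S.Queue => (S.cap i.1.1 i.1.2 : ℝ) / S.inflowProb i)
    (fun i _ => div_nonneg (Nat.cast_nonneg _) (inflowProb_nonneg i)) (Finset.mem_univ i)

/-- In each unequal coordinate the expected drop of the potential is at least the cap, hence at
least the delay difference there. -/
lemma integral_couplingPotential_le {Q R : S.State} (h : R ≤ Q)
    (hz : ∀ i, S.inflowProb i = 0 → Q i = R i) (u : S.Action) :
    S.delayCost Q - S.delayCost R +
      ∫ A, S.couplingPotential S.couplingWeight (S.next Q u A) (S.next R u A) ∂S.arrivalLaw ≤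
      S.couplingPotential S.couplingWeight Q R := by
  classical
  have hint : ∀ i : S.Queue, Integrable (fun A => (if Q i = R i then 0 else S.couplingWeight) *
      ({A | 0 < S.inflow A i} : Set S.Arrivals).indicator (1 : S.Arrivals → ℝ) A)
      S.arrivalLaw := fun i =>
    ((integrable_const (1 : ℝ)).indicator (Set.to_countable _).measurableSet).const_mul _
  have hmono := integral_mono
    (S.integrable_comp_finite (fun p : S.State × S.State =>
      S.couplingPotential S.couplingWeight p.1 p.2) fun A => (S.next Q u A, S.next R u A))
    ((integrable_const (S.couplingPotential S.couplingWeight Q R)).sub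
      (integrable_finsetSum Finset.univ fun i _ => hint i))
    fun A => couplingPotential_next_le couplingWeight_nonneg h u A
  simp only [Pi.sub_apply] at hmono
  rw [integral_sub (integrable_const _) (integrable_finsetSum Finset.univ fun i _ => hint i),
    integral_finsetSum _ fun i _ => hint i] at hmono
  have hdelay : S.delayCost Q - S.delayCost R ≤
      ∑ i, ∫ A, (if Q i = R i then 0 else S.couplingWeight) *
        ({A | 0 < S.inflow A i} : Set S.Arrivals).indicator (1 : S.Arrivals → ℝ) A
        ∂S.arrivalLaw := by
    unfold delayCost
    rw [← Finset.sum_sub_distrib]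
    refine Finset.sum_le_sum fun i _ => ?_
    rw [integral_const_mul, integral_indicator_one (Set.to_countable _).measurableSet]
    by_cases hi : Q i = R i
    · simp [hi]
    · rw [if_neg hi]
      have h1 := cap_le_couplingWeight_mul fun h0 => hi (hz i h0)
      have h2 : ((Q i : ℕ) : ℝ) ≤ S.cap i.1.1 i.1.2 := by
        exact_mod_cast Nat.lt_succ_iff.1 (Q i).2
      have h3 : (0 : ℝ) ≤ (R i : ℕ) := Nat.cast_nonneg _
      unfold inflowProb at h1
      linarith
  simp only [integral_const, probReal_univ, one_smul] at hmono
  linarith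

/-! ### Bounds on discounted solutions, uniform in the discount. -/

namespace IsDiscountedSolution

variable {α c : ℝ} {V : S.State → ℝ}

lemma sub_le_couplingPotential (h : S.IsDiscountedSolution α c V) (h0 : 0 ≤ α) (h1 : α < 1)
    {Q R : S.State} (hQR : R ≤ Q) (hz : ∀ i, S.inflowProb i = 0 → Q i = R i) :
    V Q - V R ≤ S.couplingPotential S.couplingWeight Q R := by
  -- This set of pairs is preserved by a coupled step, so the largest excess `D` over the potential
  -- satisfies `D ≤ α * D`.
  let P := {p : S.State × S.State // p.2 ≤ p.1 ∧ ∀ i, S.inflowProb i = 0 → p.1 i = p.2 i}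
  have : Nonempty P := ⟨⟨(Q, R), hQR, hz⟩⟩
  let f := S.couplingPotential S.couplingWeight
  obtain ⟨⟨⟨Q₀, R₀⟩, h₀, hz₀⟩, hmax⟩ :=
    Finite.exists_max fun p : P => V p.1.1 - V p.1.2 - f p.1.1 p.1.2
  dsimp only at h₀ hz₀ hmax
  set D := V Q₀ - V R₀ - f Q₀ R₀ with hD
  obtain ⟨u, hu⟩ := h.exists_sub_le R₀
  have hif : Integrable (fun A => f (S.next Q₀ u A) (S.next R₀ u A)) S.arrivalLaw :=
    S.integrable_comp_finite (fun p : S.State × S.State => f p.1 p.2)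
      fun A => (S.next Q₀ u A, S.next R₀ u A)
  have hE : ∫ A, (V (S.next Q₀ u A) - V (S.next R₀ u A)) ∂S.arrivalLaw ≤
      D + ∫ A, f (S.next Q₀ u A) (S.next R₀ u A) ∂S.arrivalLaw := by
    refine (integral_mono ((S.integrable_next _ _ _).sub (S.integrable_next _ _ _))
      ((integrable_const D).add hif) fun A => ?_).trans (le_of_eq ?_)
    · have := hmax ⟨(S.next Q₀ u A, S.next R₀ u A), next_mono h₀ u A,
        fun i hi => next_apply_congr u A fun _ => hz₀ i hi⟩
      simp only [Pi.sub_apply, Pi.add_apply]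
      dsimp only at this
      linarith
    · simp only [Pi.add_apply]
      rw [integral_add (integrable_const _) hif]
      simp
  have hpot := integral_couplingPotential_le h₀ hz₀ u
  have hnn : 0 ≤ ∫ A, f (S.next Q₀ u A) (S.next R₀ u A) ∂S.arrivalLaw :=
    integral_nonneg fun A => couplingPotential_nonneg couplingWeight_nonneg _ _
  have hle := hu Q₀
  have hE' := mul_le_mul_of_nonneg_left hE h0
  have hα := mul_le_mul_of_nonneg_right h1.le hnn
  have hD0 : D ≤ 0 := by
    have : (1 - α) * D ≤ 0 := by
      change S.delayCost Q₀ - S.delayCost R₀ +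
        ∫ A, f (S.next Q₀ u A) (S.next R₀ u A) ∂S.arrivalLaw ≤ f Q₀ R₀ at hpot
      linarith
    by_contra! hpos
    have := mul_pos (sub_pos.2 h1) hpos
    linarith
  have := hmax ⟨(Q, R), hQR, hz⟩
  dsimp only at this
  change V Q - V R ≤ f Q R
  linarith

/-- At a minimizer, `V` is at least `α` times itself because stage costs are nonnegative. -/
lemma nonneg (h : S.IsDiscountedSolution α 0 V) (h0 : 0 ≤ α) (h1 : α < 1) (Q : S.State) :
    0 ≤ V Q := by
  obtain ⟨Q₀, hmin⟩ := Finite.exists_min V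
  obtain ⟨u, hu⟩ := (h Q₀).1
  have hE : V Q₀ ≤ ∫ A, V (S.next Q₀ u A) ∂S.arrivalLaw := by
    simpa using integral_mono (integrable_const (V Q₀)) (S.integrable_next V Q₀ u)
      fun A => hmin _
  have hE' := mul_le_mul_of_nonneg_left hE h0
  have hg := stageCost_nonneg Q₀ u
  dsimp only at hu
  refine le_trans ?_ (hmin Q)
  by_contra! hneg
  nlinarith

lemma mul_le {G : ℝ} (h : S.IsDiscountedSolution α 0 V) (h0 : 0 ≤ α) (h1 : α < 1)
    (hG : ∀ Q u, S.stageCost Q u ≤ G) (Q : S.State) : (1 - α) * V Q ≤ G := by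
  obtain ⟨Q₀, hmax⟩ := Finite.exists_max V
  have hle := (h Q₀).2 ⟨S.idle, rfl⟩
  have hE : ∫ A, V (S.next Q₀ S.idle A) ∂S.arrivalLaw ≤ V Q₀ := by
    simpa using integral_mono (S.integrable_next V Q₀ S.idle) (integrable_const (V Q₀))
      fun A => hmax _
  have hE' := mul_le_mul_of_nonneg_left hE h0
  have hg := hG Q₀ S.idle
  have := mul_le_mul_of_nonneg_left (hmax Q) (sub_pos.2 h1).le
  dsimp only at hle
  linarith

end IsDiscountedSolution

/-- The action in which the MBS multicasts content `m`. -/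
def mbsAction (S : HetNet) (m : Fin S.M) : S.Action :=
  ⟨fun n => if n = 0 then some m else none, by
    refine ⟨fun n k h => ?_, Or.inr fun n hn => if_neg hn⟩
    dsimp only at h
    split_ifs at h with hn
    subst hn
    simp [S.cached_zero]⟩

lemma serves_mbsAction {m : Fin S.M} {i : S.Queue} (h : i.1.2 = m) :
    S.Serves (S.mbsAction m) i := Or.inl (by simp [mbsAction, h])

lemma IsDiscountedSolution.le_of_cleared {α : ℝ} {V : S.State → ℝ} {G : ℝ}
    (h : S.IsDiscountedSolution α 0 V) (h0 : 0 ≤ α) (h1 : α < 1)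
    (hG : ∀ Q u, S.stageCost Q u ≤ G) (k : ℕ) (hk : k ≤ S.M) (Q : S.State)
    (hQ : ∀ i : S.Queue, S.inflowProb i = 0 → k ≤ i.1.2 → Q i = 0) :
    V Q ≤ V (fun _ => 0) +
      ((∑ i : S.Queue, S.couplingWeight * (S.cap i.1.1 i.1.2 : ℝ)) + k * G) := by
  induction k generalizing Q with
  | zero =>
    have := h.sub_le_couplingPotential h0 h1 (Q := Q) (R := fun _ => 0) (fun i => Fin.zero_le _)
      fun i hi => hQ i hi (Nat.zero_le _)
    have := couplingPotential_le (couplingWeight_nonneg (S := S)) Q fun _ => 0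
    simp only [Nat.cast_zero, zero_mul, add_zero]
    linarith
  | succ k ih =>
    set C := (∑ i : S.Queue, S.couplingWeight * (S.cap i.1.1 i.1.2 : ℝ)) with hC
    have hC0 : 0 ≤ C :=
      Finset.sum_nonneg fun i _ => mul_nonneg couplingWeight_nonneg (Nat.cast_nonneg _)
    have hG0 : 0 ≤ G := (stageCost_nonneg Q S.idle).trans (hG _ _)
    set u := S.mbsAction ⟨k, hk⟩ with hu
    -- Multicasting content `k` almost surely leaves every queue without inflow and with content
    -- index at least `k` empty, so the induction hypothesis applies to the next state.
    have hE : ∫ A, V (S.next Q u A) ∂S.arrivalLaw ≤ V (fun _ => 0) + (C + k * G) := by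
      have hae : (fun A => V (S.next Q u A)) ≤ᵐ[S.arrivalLaw]
          fun _ => V (fun _ => 0) + (C + k * G) := by
        filter_upwards [ae_inflow_eq_zero (S := S)] with A hA
        refine ih (by omega) _ fun i hi hki => Fin.ext ?_
        rw [Fin.val_zero]
        by_cases hs : S.Serves u i
        · rw [next_of_serves hs, hA i hi, Nat.zero_min]
        · have hne : (i.1.2 : ℕ) ≠ k := fun he => hs (serves_mbsAction (Fin.ext he))
          rw [next_of_not_serves hs, hA i hi, hQ i hi (by omega)]
          simp
      simpa using integral_mono_ae (S.integrable_next V Q u) (integrable_const _) hae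
    have hle := (h Q).2 ⟨u, rfl⟩
    dsimp only at hle
    have hE' := mul_le_mul_of_nonneg_left hE h0
    have hnn : 0 ≤ V (fun _ => 0) + (C + k * G) :=
      add_nonneg (h.nonneg h0 h1 _) (by positivity)
    have hα := mul_le_mul_of_nonneg_right h1.le hnn
    have hg := hG Q u
    push_cast
    linarith

variable (S) in
lemma exists_span_bound : ∃ B : ℝ, ∀ (α : ℝ) (V : S.State → ℝ), 0 ≤ α → α < 1 →
    S.IsDiscountedSolution α 0 V → ∀ Q, V Q - V (fun _ => 0) ≤ B := by
  obtain ⟨G, hG⟩ := S.exists_stageCost_le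
  refine ⟨(∑ i : S.Queue, S.couplingWeight * (S.cap i.1.1 i.1.2 : ℝ)) + S.M * G,
    fun α V h0 h1 h Q => ?_⟩
  have := h.le_of_cleared h0 h1 hG S.M le_rfl Q
    fun i _ hi => absurd i.1.2.2 (by omega)
  linarith

/-! ### Existence of discounted solutions and their limit. -/

lemma exists_discountedSolution (S : HetNet) {α : ℝ} (h0 : 0 ≤ α) (h1 : α < 1) :
    ∃ V, S.IsDiscountedSolution α 0 V := by
  have : Nonempty S.Action := ⟨S.idle⟩
  let F : (S.State → ℝ) → S.State → S.Action → ℝ := fun V Q u =>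
    S.stageCost Q u + α * ∫ A, V (S.next Q u A) ∂S.arrivalLaw
  choose a ha using fun (V : S.State → ℝ) (Q : S.State) => Finite.exists_min (F V Q)
  let T : (S.State → ℝ) → S.State → ℝ := fun V Q => F V Q (a V Q)
  have hone : ∀ V W Q, T V Q - T W Q ≤ α * dist V W := fun V W Q => by
    have hle : T V Q ≤ F V Q (a W Q) := ha V Q _
    have hE : ∫ A, V (S.next Q (a W Q) A) ∂S.arrivalLaw -
        ∫ A, W (S.next Q (a W Q) A) ∂S.arrivalLaw ≤ dist V W := by
      rw [← integral_sub (S.integrable_next _ _ _) (S.integrable_next _ _ _)]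
      refine (integral_mono ((S.integrable_next _ _ _).sub (S.integrable_next _ _ _))
        (integrable_const (dist V W)) fun A => ?_).trans (by simp)
      exact (le_abs_self _).trans (dist_le_pi_dist V W (S.next Q (a W Q) A))
    have hE' := mul_le_mul_of_nonneg_left hE h0
    simp only [T, F] at hle ⊢
    linarith
  have hT : ContractingWith (⟨α, h0⟩ : ℝ≥0) T := by
    refine ⟨by exact_mod_cast h1, LipschitzWith.of_dist_le_mul fun V W => ?_⟩
    rw [dist_pi_le_iff (by positivity)]
    intro Q
    rw [Real.dist_eq, abs_le]
    have h1 := hone V W Q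
    have h2 := hone W V Q
    rw [dist_comm W V] at h2
    exact ⟨by change -(α * _) ≤ _; linarith, h1⟩
  obtain ⟨V, hV⟩ : ∃ V, T V = V := ⟨_, hT.fixedPoint_isFixedPt⟩
  refine ⟨V, fun Q => ⟨⟨a V Q, ?_⟩, ?_⟩⟩
  · rw [zero_add]
    exact congrFun hV Q
  · rintro _ ⟨u, rfl⟩
    rw [zero_add, ← congrFun hV Q]
    exact ha V Q u

lemma IsDiscountedSolution.sub_const {α : ℝ} {V : S.State → ℝ}
    (h : S.IsDiscountedSolution α 0 V) (b : ℝ) :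
    S.IsDiscountedSolution α ((1 - α) * b) fun Q => V Q - b := by
  have hE : ∀ Q u, ∫ A, (V (S.next Q u A) - b) ∂S.arrivalLaw =
      ∫ A, V (S.next Q u A) ∂S.arrivalLaw - b := fun Q u => by
    rw [integral_sub (S.integrable_next _ _ _) (integrable_const _)]
    simp
  intro Q
  obtain ⟨⟨u, hu⟩, hle⟩ := h Q
  refine ⟨⟨u, ?_⟩, ?_⟩
  · simp only [hE] at hu ⊢
    linarith
  · rintro _ ⟨v, rfl⟩
    have := hle ⟨v, rfl⟩
    simp only [hE] at this ⊢
    linarith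

lemma isDiscountedSolution_of_tendsto {α : ℕ → ℝ} {c : ℕ → ℝ} {V : ℕ → S.State → ℝ}
    {α' c' : ℝ} {V' : S.State → ℝ} (h : ∀ k, S.IsDiscountedSolution (α k) (c k) (V k))
    (hα : Tendsto α atTop (𝓝 α')) (hc : Tendsto c atTop (𝓝 c'))
    (hV : Tendsto V atTop (𝓝 V')) : S.IsDiscountedSolution α' c' V' := by
  intro Q
  have hVQ : ∀ Q, Tendsto (fun k => V k Q) atTop (𝓝 (V' Q)) := tendsto_pi_nhds.1 hV
  have hr : ∀ u, Tendsto (fun k => S.stageCost Q u +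
      α k * ∫ A, V k (S.next Q u A) ∂S.arrivalLaw) atTop
      (𝓝 (S.stageCost Q u + α' * ∫ A, V' (S.next Q u A) ∂S.arrivalLaw)) := fun u => by
    simp only [integral_next]
    exact (hα.mul (tendsto_finsetSum _ fun Q' _ => (hVQ Q').const_mul _)).const_add _
  have hl : Tendsto (fun k => c k + V k Q) atTop (𝓝 (c' + V' Q)) := hc.add (hVQ Q)
  have hle : ∀ u, c' + V' Q ≤ S.stageCost Q u + α' * ∫ A, V' (S.next Q u A) ∂S.arrivalLaw :=
    fun u => le_of_tendsto_of_tendsto' hl (hr u) fun k => (h k Q).2 ⟨u, rfl⟩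
  refine ⟨?_, by rintro _ ⟨u, rfl⟩; exact hle u⟩
  -- If no action attained the limiting minimum, then, there being finitely many actions, one `k`
  -- would make all the inequalities strict, although the minimum is attained for that `k`.
  by_contra hne
  have hlt : ∀ u, ∀ᶠ k in atTop, c k + V k Q <
      S.stageCost Q u + α k * ∫ A, V k (S.next Q u A) ∂S.arrivalLaw := fun u =>
    hl.eventually_lt (hr u) (lt_of_le_of_ne (hle u) fun he => hne ⟨u, he.symm⟩)
  obtain ⟨k, hk⟩ := (eventually_all.2 hlt).exists
  obtain ⟨u, hu⟩ := (h k Q).1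
  exact (hk u).ne hu.symm

/-- The vanishing discount limit. -/
lemma exists_isBellmanSolution (S : HetNet) :
    ∃ (θ : ℝ) (V : S.State → ℝ), S.IsBellmanSolution θ V := by
  obtain ⟨B, hB⟩ := S.exists_span_bound
  obtain ⟨G, hG⟩ := S.exists_stageCost_le
  let α : ℕ → ℝ := fun k => 1 - 1 / ((k : ℝ) + 1)
  have hα0 : ∀ k, 0 ≤ α k := fun k => by
    have : 1 / ((k : ℝ) + 1) ≤ 1 := by
      rw [div_le_one (by positivity)]; linarith [Nat.cast_nonneg (α := ℝ) k]
    simp only [α]; linarith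
  have hα1 : ∀ k, α k < 1 := fun k => by
    have : 0 < 1 / ((k : ℝ) + 1) := by positivity
    simp only [α]; linarith
  have hα : Tendsto α atTop (𝓝 1) := by
    simpa only [sub_zero] using
      tendsto_one_div_add_atTop_nhds_zero_nat.const_sub (1 : ℝ)
  choose V hV using fun k => S.exists_discountedSolution (hα0 k) (hα1 k)
  let z : S.State := fun _ => 0
  -- Subtracting `V k z` from the solution turns it into one with constant `(1 - α k) * V k z`;
  -- these pairs stay in a fixed box.
  let x : ℕ → ℝ × (S.State → ℝ) := fun k => ((1 - α k) * V k z, fun Q => V k Q - V k z)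
  have hx : ∀ k, x k ∈ Set.Icc (0, fun _ => 0) (G, fun _ => B) := fun k =>
    ⟨⟨mul_nonneg (sub_pos.2 (hα1 k)).le ((hV k).nonneg (hα0 k) (hα1 k) z),
      fun Q => sub_nonneg.2 ((hV k).monotone (hα0 k) (hα1 k).le fun i => Fin.zero_le _)⟩,
      (hV k).mul_le (hα0 k) (hα1 k) hG z, fun Q => hB _ _ (hα0 k) (hα1 k) (hV k) Q⟩
  obtain ⟨⟨θ, W⟩, -, φ, hφ, hlim⟩ := tendsto_subseq_of_bounded (Metric.isBounded_Icc _ _) hx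
  refine ⟨θ, W, isDiscountedSolution_one.1 (isDiscountedSolution_of_tendsto
    (fun k => (hV (φ k)).sub_const (V (φ k) z)) (hα.comp hφ.tendsto_atTop)
    hlim.fst_nhds hlim.snd_nhds)⟩

end HetNet

theorem theorem1 (S : HetNet) :
    -- the Bellman equation has a solution
    (∃ (θ : ℝ) (V : S.State → ℝ), S.IsBellmanSolution θ V) ∧
    ∀ (θ : ℝ) (V : S.State → ℝ), S.IsBellmanSolution θ V →
      -- `θ` is the minimum average cost, and choosing an action from the argmin attains it
      (∀ Q₁ : S.State, IsLeast (Set.range fun μ : S.Policy => S.avgCost μ Q₁) θ) ∧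
      (∀ μ : S.Policy, (∀ Q, μ Q ∈ S.optimalActions V Q) → ∀ Q₁, S.avgCost μ Q₁ = θ) ∧
      -- idling is optimal on the idle region
      (∀ Q ∈ S.idleRegion V, S.idle ∈ S.optimalActions V Q) ∧
      -- `u` is optimal once one queue that it serves has reached its threshold
      (∀ (u : S.Action) (n : Fin (S.N + 1)) (m : Fin S.M) (hm : m ∈ S.cached n),
        u.1 n = some m → ∀ Q : S.State,
          S.phiMinus V u ⟨(n, m), hm⟩ Q ≤
            (Q ⟨(n, m), hm⟩ : WithTop (Fin (S.cap n m + 1))) →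
          u ∈ S.optimalActions V Q) ∧
      -- the MBS threshold for `m` is non-increasing in the queue of each SBS that stores `m`
      (∀ (u : S.Action) (m : Fin S.M), u.1 0 = some m →
        ∀ (n : Fin (S.N + 1)) (hm : m ∈ S.cached n), n ≠ 0 → ∀ Q : S.State,
          Antitone fun x : Fin (S.cap n m + 1) =>
            S.phiMinus V u (S.mbsQueue m) (Function.update Q ⟨(n, m), hm⟩ x)) := by
  refine ⟨S.exists_isBellmanSolution, fun θ V h => ?_⟩
  have hV : Monotone V :=
    (HetNet.isDiscountedSolution_one.2 h).monotone zero_le_one le_rfl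
  refine ⟨h.isLeast_avgCost, fun μ hμ Q₁ => h.avgCost_eq hμ Q₁,
    fun Q hQ => HetNet.idle_mem_optimalActions hV hQ,
    fun u n m hm hu Q hQ =>
      HetNet.mem_optimalActions_of_phiMinus_le hV (i := ⟨(n, m), hm⟩) (Or.inr hu) hQ,
    fun u m hu n hm _ Q x y hxy => HetNet.phiMinus_mono hV _ ?_ fun j hj => ?_⟩
  · exact update_le_update_iff.2 ⟨hxy, fun j _ => le_rfl⟩
  · have hne : j ≠ ⟨(n, m), hm⟩ := by
      rintro rfl
      exact hj (Or.inl hu)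
    rw [Function.update_of_ne hne, Function.update_of_ne hne]
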